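/- A (real-time) deterministic push-down automaton (DPDA) is a tuple $M=(Q,\Sigma,\Gamma,\delta,\bot)$ with a finite non-empty set $Q$ of states, finite input and stack alphabets $\Sigma,\Gamma$, a bottom symbol $\bot\in\Gamma$, and a total transition function $\delta\colon Q\times\Sigma\times\Gamma\to Q\times\Gamma^*$ such that, whenever $\delta(q,\sigma,x)=(q',\gamma)$ and $\bot$ occurs in $\gamma$, then $x=\bot$ and $\bot$ occurs in $\gamma$ only as its first (lowest) symbol. (Start and final states are irrelevant here.) A configuration is a pair in $Q\times\Gamma^*$, the right end of the stack word being the top; reading $\sigma\in\Sigma$ leads from $(q,\upsilon x)$ with $x\in\Gamma$ to $(q',\upsilon\gamma)$ if $\delta(q,\sigma,x)=(q',\gamma)$, and no transition is possible when the stack word is empty. We write $c\xrightarrow{w}d$ if reading the letters of $w\in\Sigma^*$ one after the other leads from $c$ to $d$. A run in which no transition decreases the stack height (the length of the stack word), or in which no transition increases it, is called a stroke. A word $w\in\Sigma^*$ is an $n$-turn synchronizing word for $M$ in the arbitrary stack model if there is a state $\overline q\in Q$ such that for every $q\in Q$ there is $\upsilon_q\in\Gamma^*$ with $(q,\bot)\xrightarrow{w}(\overline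 q,\upsilon_q)$ and this run is a concatenation of at most $n+1$ strokes. It is one in the same stack model if moreover $\upsilon_q=\upsilon_{q'}$ for all $q,q'\in Q$, and in the empty stack model if moreover $\upsilon_q=\bot$ for all $q\in Q$. The problems $n$-Turn-Sync-DPDA-Empty, $n$-Turn-Sync-DPDA-Same and $n$-Turn-Sync-DPDA-Arb ask, given (a finite description of) a DPDA $M$, whether $M$ has an $n$-turn synchronizing word in the empty, the same, and the arbitrary stack model, respectively. Theorem. Each of the three problems 1-Turn-Sync-DPDA-Empty, 1-Turn-Sync-DPDA-Same and 1-Turn-Sync-DPDA-Arb is undecidable. -/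

import Mathlib

/-!
A queue automaton that removes one symbol and appends a word in each step halts from the queue `u`
if and only if `u ++ out s = s` for some `s`, where `out s` is the word that it appends while it
removes the symbols of `s`: this equation says that every removed symbol is the one that was
queued at its position. So halting is the question whether two sequential transducers, of which one
copies `s` and the other prints `u ++ out s`, print the same word on some input.

A push-down automaton checks such an agreement with one turn. It has one state for each transducer;
in the first part of the input it pushes what its transducer prints, and in the second part it
compares the input with its stack from the top down. As all runs read the same second part, they
succeed together only if all transducers have printed the same word.

Queue automata have an undecidable halting problem, since the visited part of the tape of a Turing
machine can be kept in a queue, in cyclic order.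
-/

/-- A real-time deterministic push-down automaton with states `Q`, input alphabet `A` and stack
alphabet `Γ`; start and final states play no role for synchronization and are left out.
Stack contents and pushed words are lists whose *head is the top* of the stack, so the lowest
symbol is the last entry. -/
structure DPDA (Q A Γ : Type) where
  /-- The bottom-of-stack symbol. -/
  bot : Γ
  /-- The (total) transition function: the top symbol is replaced by the returned word. -/
  δ : Q → A → Γ → Q × List Γ
  /-- A word written by a transition contains the bottom symbol only as its lowest symbol, and
  only if the symbol that it replaces is the bottom symbol. -/
  bot_lowest : ∀ q a x, bot ∈ (δ q a x).2 → x = bot ∧ bot ∉ (δ q a x).2.dropLast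

namespace DPDA

variable {Q A Γ : Type}

/-- `M.Step a c d`: reading the letter `a` leads from configuration `c` to configuration `d`.
There is no step out of a configuration whose stack content is the empty word. -/
def Step (M : DPDA Q A Γ) (a : A) : Q × List Γ → Q × List Γ → Prop
  | (_, []), _ => False
  | (q, x :: υ), d => d = ((M.δ q a x).1, (M.δ q a x).2 ++ υ)

/-- `M.RunWith R c w d`: reading `w` leads from `c` to `d`, and each single transition on the way
changes the stack height from some `h` to some `h'` with `R h h'`. -/
inductive RunWith (M : DPDA Q A Γ) (R : ℕ → ℕ → Prop) :
    Q × List Γ → List A → Q × List Γ → Prop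
  | nil (c : Q × List Γ) : RunWith M R c [] c
  | cons {c d e : Q × List Γ} {a : A} {w : List A} :
      M.Step a c d → R c.2.length d.2.length → RunWith M R d w e → RunWith M R c (a :: w) e

/-- Reading `w` leads from `c` to `d`. -/
def Run (M : DPDA Q A Γ) (c : Q × List Γ) (w : List A) (d : Q × List Γ) : Prop :=
  M.RunWith (fun _ _ => True) c w d

/-- A run in which no transition decreases the stack height. -/
def Upstroke (M : DPDA Q A Γ) (c : Q × List Γ) (w : List A) (d : Q × List Γ) : Prop :=
  M.RunWith (fun h h' => h ≤ h') c w d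

/-- A run in which no transition increases the stack height. -/
def Downstroke (M : DPDA Q A Γ) (c : Q × List Γ) (w : List A) (d : Q × List Γ) : Prop :=
  M.RunWith (fun h h' => h' ≤ h) c w d

/-- The run from `c` to `d` on the given word is a concatenation of `k` strokes. -/
inductive Strokes (M : DPDA Q A Γ) : ℕ → Q × List Γ → List A → Q × List Γ → Prop
  | zero (c : Q × List Γ) : Strokes M 0 c [] c
  | succ {k : ℕ} {c d e : Q × List Γ} {u v : List A} :
      M.Upstroke c u d ∨ M.Downstroke c u d → Strokes M k d v e → Strokes M (k + 1) c (u ++ v) e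

/-- The requirement on the stack contents at the end of a synchronizing word. -/
inductive StackModel
  | empty
  | same
  | arbitrary

/-- The final stack contents `υ q` of the runs started in the states `q` are as the stack model
requires. -/
def StackModel.Holds (bot : Γ) (υ : Q → List Γ) : StackModel → Prop
  | .empty => ∀ q, υ q = [bot]
  | .same => ∀ q q', υ q = υ q'
  | .arbitrary => True

/-- `w` is an `n`-turn synchronizing word for `M` in the given stack model: the runs on `w` from
all states, started with only the bottom symbol on the stack, exist, end in one common state with
admissible stack contents, and each splits into at most `n + 1` strokes. -/
def IsTurnSyncWord (M : DPDA Q A Γ) (n : ℕ) (m : StackModel) (w : List A) : Prop :=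
  ∃ (p : Q) (υ : Q → List Γ),
    (∀ q, M.Run (q, [M.bot]) w (p, υ q)) ∧ m.Holds M.bot υ ∧
    ∀ q, ∃ k ≤ n + 1, M.Strokes k (q, [M.bot]) w (p, υ q)

end DPDA

/-- The instances of the decision problems: a DPDA with finitely many states, input letters and
stack symbols, numbered `0, 1, 2, …`, and at least one state. -/
structure FinDPDA where
  numStates : ℕ
  numLetters : ℕ
  numStack : ℕ
  numStates_pos : 0 < numStates
  toDPDA : DPDA (Fin numStates) (Fin numLetters) (Fin numStack)

namespace FinDPDA

/-- Finite descriptions of automata: the three sizes, the number of the bottom symbol, and the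
transition table. -/
abbrev Code : Type := ℕ × ℕ × ℕ × ℕ × List (List (List (ℕ × List ℕ)))

/-- The description of an automaton, with its transition table written out row by row. -/
def code (M : FinDPDA) : Code :=
  (M.numStates, M.numLetters, M.numStack, M.toDPDA.bot,
    List.ofFn fun q => List.ofFn fun a => List.ofFn fun x =>
      (((M.toDPDA.δ q a x).1 : ℕ), (M.toDPDA.δ q a x).2.map Fin.val))

/-- Distinct automata have distinct descriptions. -/
theorem code_injective : Function.Injective code := by
  rintro ⟨n, m, k, hn, b, δ, h⟩ ⟨n', m', k', hn', b', δ', h'⟩ e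
  simp only [code, Prod.mk.injEq] at e
  obtain ⟨rfl, rfl, rfl, hb, ht⟩ := e
  obtain rfl := Fin.ext hb
  have : δ = δ' := by
    funext q a x
    have h1 := congrFun (List.ofFn_injective
      (congrFun (List.ofFn_injective (congrFun (List.ofFn_injective ht) q)) a)) x
    simp only [Prod.mk.injEq] at h1
    exact Prod.ext (Fin.ext h1.1) (List.map_injective_iff.2 Fin.val_injective h1.2)
  subst this
  rfl

/-- The question of the `n`-turn synchronization problem in the given stack model. -/
def TurnSync (n : ℕ) (m : DPDA.StackModel) (M : FinDPDA) : Prop :=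
  ∃ w, M.toDPDA.IsTurnSyncWord n m w

/-- A decision problem about automata is decidable if some algorithm answers it correctly on the
description of every automaton (what it answers on other inputs is irrelevant). -/
def IsDecidable (P : FinDPDA → Prop) : Prop :=
  ∃ D : Code → Prop, ComputablePred D ∧ ∀ M : FinDPDA, D M.code ↔ P M

end FinDPDA

namespace DPDA

variable {Q A Γ : Type} {M : DPDA Q A Γ}

theorem RunWith.mono {R R' : ℕ → ℕ → Prop} (h : ∀ i j, R i j → R' i j) {c d : Q × List Γ}
    {w : List A} (hw : M.RunWith R c w d) : M.RunWith R' c w d := by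
  induction hw with
  | nil => exact .nil _
  | cons hs hR _ ih => exact .cons hs (h _ _ hR) ih

theorem RunWith.append {R : ℕ → ℕ → Prop} {c d e : Q × List Γ} {u v : List A}
    (hu : M.RunWith R c u d) (hv : M.RunWith R d v e) : M.RunWith R c (u ++ v) e := by
  induction hu with
  | nil => exact hv
  | cons hs hR _ ih => exact .cons hs hR (ih hv)

theorem RunWith.cons_of_δ_eq {R : ℕ → ℕ → Prop} {q q' : Q} {x : Γ} {υ γ : List Γ} {a : A}
    {w : List A} {d : Q × List Γ} (hδ : M.δ q a x = (q', γ))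
    (hR : R (υ.length + 1) (γ.length + υ.length)) (h : M.RunWith R (q', γ ++ υ) w d) :
    M.RunWith R (q, x :: υ) (a :: w) d := by
  refine .cons (d := (q', γ ++ υ)) ?_ ?_ h
  · simp [Step, hδ]
  · simpa using hR

theorem run_nil_iff {c d : Q × List Γ} : M.Run c [] d ↔ c = d := by
  constructor
  · rintro ⟨⟩
    rfl
  · rintro rfl
    exact .nil _

theorem run_cons_iff {q : Q} {x : Γ} {υ : List Γ} {a : A} {w : List A} {d : Q × List Γ} :
    M.Run (q, x :: υ) (a :: w) d ↔ M.Run ((M.δ q a x).1, (M.δ q a x).2 ++ υ) w d := by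
  constructor
  · rintro (_ | ⟨hs, _, hr⟩)
    cases hs
    exact hr
  · exact fun h => .cons rfl trivial h

theorem Strokes.run {k : ℕ} {c d : Q × List Γ} {w : List A} (h : M.Strokes k c w d) :
    M.Run c w d := by
  induction h with
  | zero => exact .nil _
  | succ h _ ih =>
    refine RunWith.append ?_ ih
    rcases h with h | h <;> exact h.mono fun _ _ _ => trivial

theorem Downstroke.strokes {c d : Q × List Γ} {w : List A} (h : M.Downstroke c w d) :
    M.Strokes 1 c w d := by
  simpa using Strokes.succ (.inr h) (.zero d)

theorem Upstroke.strokes_append {k : ℕ} {c d e : Q × List Γ} {u v : List A}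
    (hu : M.Upstroke c u d) (hv : M.Strokes k d v e) : M.Strokes (k + 1) c (u ++ v) e :=
  .succ (.inl hu) hv

theorem isTurnSyncWord_of_strokes_bot {n : ℕ} {m : StackModel} {w : List A} {p : Q}
    (h : ∀ q, ∃ k ≤ n + 1, M.Strokes k (q, [M.bot]) w (p, [M.bot])) : M.IsTurnSyncWord n m w := by
  refine ⟨p, fun _ => [M.bot], fun q => ?_, ?_, h⟩
  · obtain ⟨k, -, hk⟩ := h q
    exact hk.run
  · cases m
    exacts [fun _ => rfl, fun _ _ => rfl, trivial]

end DPDA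

/-- A queue automaton: in state `p`, the first symbol `x` of the queue is removed, and if
`next p x = some (q, w)`, then the word `w` is appended to the queue and the state changes to `q`.
The automaton halts when the queue is empty or `next p x = none`. -/
structure QueueAutomaton (P S : Type) where
  next : P → S → Option (P × List S)

/-- A sequential transducer with an initialization: `start p` is the state to which the start
signal leads from `p`, and the word that is printed at this moment; `next p x` is the state after
reading `x` in state `p`, and the word that is printed then. -/
structure Transducer (P S : Type) where
  start : P → P × List S
  next : P → S → P × List S

namespace Transducer

variable {P S : Type}

/-- The word printed while `s` is read from state `p` on, without a start signal. -/
def out (T : Transducer P S) : P → List S → List S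
  | _, [] => []
  | p, x :: s => (T.next p x).2 ++ T.out (T.next p x).1 s

/-- The word printed while first the start signal and then `s` is read from state `p` on. -/
def output (T : Transducer P S) (p : P) (s : List S) : List S :=
  (T.start p).2 ++ T.out (T.start p).1 s

end Transducer

namespace QueueAutomaton

variable {P S : Type} (A : QueueAutomaton P S)

/-- The next configuration of a queue automaton, a configuration being a state with a queue. -/
def step : P × List S → Option (P × List S)
  | (_, []) => none
  | (p, x :: v) => (A.next p x).map fun d => (d.1, v ++ d.2)

open StateTransition

theorem eval_dom_cons_iff {p q : P} {x : S} {v w : List S} (h : A.next p x = some (q, w)) :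
    (eval A.step (p, x :: v)).Dom ↔ (eval A.step (q, v ++ w)).Dom := by
  have hstep : (q, v ++ w) ∈ A.step (p, x :: v) := by simp [step, h]
  rw [reaches_eval (.single hstep)]

theorem eval_dom_of_step_eq_none {c : P × List S} (h : A.step c = none) :
    (eval A.step c).Dom :=
  Part.dom_iff_mem.2 ⟨c, mem_eval.2 ⟨.refl, h⟩⟩

/-- The states of the transducer for a queue automaton with states `P`: it starts from `copy` or
from any other state, and is in the state `halted` after the automaton has stopped. -/
inductive TransducerState (P : Type)
  | copy
  | simulate (p : P)
  | halted
  deriving Fintype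

instance {P : Type} [Finite P] : Finite (TransducerState P) :=
  let _ := Fintype.ofFinite P
  inferInstance

/-- From the state `copy`, the transducer copies its input. From any other state, it prints the
symbols that are put into the queue of `A`, from the configuration `(p₀, u)` on, if the input is
the sequence of the symbols removed from the queue. -/
def transducer (p₀ : P) (u : List S) : Transducer (TransducerState P) S where
  start
    | .copy => (.copy, [])
    | _ => (.simulate p₀, u)
  next
    | .copy, x => (.copy, [x])
    | .simulate p, x => (A.next p x).elim (.halted, []) fun d => (.simulate d.1, d.2)
    | .halted, _ => (.halted, [])

variable {A} {p₀ : P} {u : List S}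

theorem transducer_out_copy (s : List S) : (A.transducer p₀ u).out .copy s = s := by
  induction s with
  | nil => rfl
  | cons x s ih => exact congrArg (x :: ·) ih

theorem transducer_out_halted (s : List S) : (A.transducer p₀ u).out .halted s = [] := by
  induction s with
  | nil => rfl
  | cons _ _ ih => exact ih

theorem transducer_out_simulate_of_none {p : P} {x : S} (h : A.next p x = none) (s : List S) :
    (A.transducer p₀ u).out (.simulate p) (x :: s) = [] := by
  simp only [Transducer.out, transducer, h, Option.elim_none, List.nil_append]
  exact transducer_out_halted s

theorem transducer_out_simulate_of_some {p q : P} {x : S} {w : List S}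
    (h : A.next p x = some (q, w)) (s : List S) :
    (A.transducer p₀ u).out (.simulate p) (x :: s) =
      w ++ (A.transducer p₀ u).out (.simulate q) s := by
  simp only [Transducer.out, transducer, h, Option.elim_some]

theorem eval_dom_of_append_out_eq {p : P} {v s : List S}
    (h : v ++ (A.transducer p₀ u).out (.simulate p) s = s) : (eval A.step (p, v)).Dom := by
  induction s generalizing p v with
  | nil =>
    obtain rfl := (List.append_eq_nil_iff.1 h).1
    exact A.eval_dom_of_step_eq_none rfl
  | cons x s ih =>
    obtain _ | ⟨y, v⟩ := v
    · exact A.eval_dom_of_step_eq_none rfl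
    rw [List.cons_append, List.cons.injEq] at h
    obtain ⟨rfl, h⟩ := h
    cases hnext : A.next p y with
    | none => exact A.eval_dom_of_step_eq_none (by simp [step, hnext])
    | some d =>
      rw [transducer_out_simulate_of_some hnext, ← List.append_assoc] at h
      exact (A.eval_dom_cons_iff hnext).2 (ih h)

theorem exists_append_out_eq_of_reaches {c d : P × List S} (hcd : Reaches A.step c d)
    (hd : A.step d = none) :
    ∃ s, c.2 ++ (A.transducer p₀ u).out (.simulate c.1) s = s := by
  induction hcd using Relation.ReflTransGen.head_induction_on with
  | refl =>
    obtain ⟨p, _ | ⟨x, v⟩⟩ := d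
    · exact ⟨[], rfl⟩
    · exact ⟨x :: v, by simp [transducer_out_simulate_of_none (Option.map_eq_none_iff.1 hd)]⟩
  | @head c c' hstep _ ih =>
    obtain ⟨p, _ | ⟨x, v⟩⟩ := c
    · cases hstep
    obtain ⟨⟨q, w⟩, hnext, rfl⟩ := Option.map_eq_some_iff.1 hstep
    obtain ⟨s, hs⟩ := ih
    refine ⟨x :: s, ?_⟩
    rw [transducer_out_simulate_of_some hnext, List.cons_append, ← List.append_assoc, hs]

theorem exists_forall_output_eq_iff :
    (∃ s t, ∀ q, (A.transducer p₀ u).output q s = t) ↔ (eval A.step (p₀, u)).Dom := by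
  constructor
  · rintro ⟨s, t, h⟩
    obtain rfl : s = t := (transducer_out_copy s).symm.trans (h .copy)
    exact eval_dom_of_append_out_eq (h .halted)
  · intro h
    obtain ⟨d, hreaches, hd⟩ := (Part.dom_iff_mem.1 h).imp fun _ => mem_eval.1
    obtain ⟨s, hs⟩ := exists_append_out_eq_of_reaches hreaches hd
    exact ⟨s, s, fun
      | .copy => transducer_out_copy s
      | .simulate _ | .halted => hs⟩

end QueueAutomaton

namespace Transducer

open DPDA

/-- The states of the automaton `sync T` for a transducer with states `P`. -/
inductive SyncState (P : Type)
  /-- The sink in which all synchronizing runs end. -/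
  | done
  /-- Reached when the input differs from the stack contents. -/
  | trap
  /-- Compare the input with the stack contents. -/
  | check
  /-- Simulate the transducer, and push what it prints. -/
  | run (p : P)
  deriving Fintype

instance {P : Type} [Finite P] : Finite (SyncState P) :=
  let _ := Fintype.ofFinite P
  inferInstance

instance {P : Type} : Nonempty (SyncState P) := ⟨.done⟩

/-- The stack symbols of the automaton `sync T`: symbols of the transducer, above the symbol
`mark`, above the symbol `bot`. -/
inductive SyncStack (S : Type)
  | bot
  | mark
  | sym (x : S)
  deriving Fintype

instance {S : Type} [Finite S] : Finite (SyncStack S) :=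
  let _ := Fintype.ofFinite S
  inferInstance

variable {P S : Type}

/-- The stack contents that represent a word. -/
abbrev symStack (l : List S) : List (SyncStack S) := l.map .sym ++ [.mark, .bot]

theorem exists_symStack_eq_cons (l : List S) : ∃ y υ, symStack l = y :: υ ∧ y ≠ .bot := by
  cases l <;> exact ⟨_, _, rfl, by simp⟩

theorem map_some_append_none_cons_inj {s s' : List S} {t t' : List (Option S)} :
    s.map some ++ none :: t = s'.map some ++ none :: t' ↔ s = s' ∧ t = t' := by
  induction s generalizing s' with
  | nil => cases s' <;> simp
  | cons x s ih => cases s' <;> simp [ih, and_assoc]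

/-- The transitions of `sync T` at the bottom of the stack. The letter `none` is the start signal of
the transducer. -/
def syncBot (T : Transducer P S) : SyncState P → Option S → SyncState P × List (SyncStack S)
  | .run p, none => (.run (T.start p).1, symStack (T.start p).2.reverse)
  | .run p, some _ => (.run p, [.bot])
  | _, _ => (.done, [.bot])

variable [DecidableEq S]

/-- The transitions of `sync T` above the bottom of the stack. The letter `none` ends the input of
the transducer, and later the word that is compared with the stack contents. -/
def syncTop (T : Transducer P S) :
    SyncState P → Option S → SyncStack S → SyncState P × List (SyncStack S)
  | .run p, some x, y => (.run (T.next p x).1, (T.next p x).2.reverse.map .sym ++ [y])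
  | .run _, none, y => (.check, [y])
  | .check, some x, .sym y => if x = y then (.check, []) else (.trap, [.sym y])
  | .check, none, .mark => (.done, [])
  | .done, _, y => (.done, [y])
  | _, _, y => (.trap, [y])

/-- The automaton that has a synchronizing word if and only if the transducer prints the same word
on some input from all of its states: this word is on the stack, and must be read off in the
second part of the input, when the last delimiter is reached. -/
def sync (T : Transducer P S) : DPDA (SyncState P) (Option S) (SyncStack S) where
  bot := .bot
  δ q a y := match y with
    | .bot => T.syncBot q a
    | .mark => T.syncTop q a .mark
    | .sym y => T.syncTop q a (.sym y)
  bot_lowest q a y := by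
    rcases y with _ | _ | y
    · cases q <;> cases a <;> simp [syncBot]
    all_goals cases q <;> cases a <;> grind [syncTop]

variable {T : Transducer P S}

theorem sync_δ_of_ne_bot {y : SyncStack S} (hy : y ≠ .bot) (q : SyncState P) (a : Option S) :
    T.sync.δ q a y = T.syncTop q a y := by
  cases y
  exacts [absurd rfl hy, rfl, rfl]

theorem fst_eq_done_of_sync_run {w : List (Option S)} {y : SyncStack S} {υ : List (SyncStack S)}
    {d : SyncState P × List (SyncStack S)} (h : T.sync.Run (.done, y :: υ) w d) :
    d.1 = .done := by
  induction w with
  | nil => rw [← run_nil_iff.1 h]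
  | cons a w ih =>
    rw [run_cons_iff] at h
    apply ih
    cases y <;> simpa [sync, syncBot, syncTop] using h

theorem not_sync_run_trap {w : List (Option S)} {y : SyncStack S} (hy : y ≠ .bot)
    {υ υ' : List (SyncStack S)} : ¬ T.sync.Run (.trap, y :: υ) w (.done, υ') := by
  induction w with
  | nil => exact fun h => by cases run_nil_iff.1 h
  | cons a w ih => rwa [run_cons_iff, sync_δ_of_ne_bot hy]

theorem exists_eq_of_sync_run_check {w : List (Option S)} {l : List S} {υ : List (SyncStack S)}
    (h : T.sync.Run (.check, symStack l) w (.done, υ)) :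
    ∃ r, w = l.map some ++ none :: r := by
  induction l generalizing w with
  | nil =>
    obtain _ | ⟨_ | x, w⟩ := w
    · cases run_nil_iff.1 h
    · exact ⟨w, rfl⟩
    · exact absurd (run_cons_iff.1 h) (not_sync_run_trap (by simp))
  | cons x l ih =>
    obtain _ | ⟨_ | y, w⟩ := w
    · cases run_nil_iff.1 h
    · exact absurd (run_cons_iff.1 h) (not_sync_run_trap (by simp))
    · by_cases hyx : y = x
      · subst hyx
        obtain ⟨r, rfl⟩ := ih (by simpa [sync, syncTop] using run_cons_iff.1 h)
        exact ⟨r, rfl⟩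
      · replace h := run_cons_iff.1 h
        simp only [sync, syncTop, if_neg hyx] at h
        exact absurd h (not_sync_run_trap (by simp))

theorem exists_eq_of_sync_run_run {w : List (Option S)} {p : P} {l : List S}
    {υ : List (SyncStack S)} (h : T.sync.Run (.run p, symStack l) w (.done, υ)) :
    ∃ s r, w = s.map some ++ none :: (((T.out p s).reverse ++ l).map some ++ none :: r) := by
  induction w generalizing l p with
  | nil => cases run_nil_iff.1 h
  | cons a w ih =>
    obtain ⟨y, υ', hl, hy⟩ := exists_symStack_eq_cons l
    rw [hl, run_cons_iff, sync_δ_of_ne_bot hy] at h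
    cases a with
    | none =>
      obtain ⟨r, rfl⟩ := exists_eq_of_sync_run_check (by simpa [syncTop, ← hl] using h)
      exact ⟨[], r, rfl⟩
    | some x =>
      obtain ⟨s, r, rfl⟩ := ih (p := (T.next p x).1) (l := (T.next p x).2.reverse ++ l)
        (by simpa [syncTop, symStack, ← hl] using h)
      exact ⟨x :: s, r, by simp [out]⟩

theorem exists_eq_of_sync_run_bot {w : List (Option S)} {p : P} {υ : List (SyncStack S)}
    (h : T.sync.Run (.run p, [.bot]) w (.done, υ)) :
    ∃ (v s : List S) (r : List (Option S)), w = v.map some ++ none ::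
      (s.map some ++ none :: ((T.output p s).reverse.map some ++ none :: r)) := by
  induction w with
  | nil => cases run_nil_iff.1 h
  | cons a w ih =>
    rw [run_cons_iff] at h
    cases a with
    | none =>
      obtain ⟨s, r, rfl⟩ := exists_eq_of_sync_run_run (p := (T.start p).1)
        (l := (T.start p).2.reverse) (by simpa [sync, syncBot] using h)
      exact ⟨[], s, r, by simp [output]⟩
    | some x =>
      obtain ⟨v, s, r, rfl⟩ := ih h
      exact ⟨x :: v, s, r, rfl⟩

theorem exists_forall_output_eq_of_isTurnSyncWord {n : ℕ} {m : StackModel} {w : List (Option S)}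
    (h : T.sync.IsTurnSyncWord n m w) : ∃ s t, ∀ p, T.output p s = t := by
  obtain ⟨q, υ, hrun, -, -⟩ := h
  obtain rfl : q = .done := fst_eq_done_of_sync_run (hrun .done)
  obtain _ | ⟨⟨p₀⟩⟩ := isEmpty_or_nonempty P
  · exact ⟨[], [], isEmptyElim⟩
  obtain ⟨v₀, s₀, r₀, hw₀⟩ := exists_eq_of_sync_run_bot (hrun (.run p₀))
  refine ⟨s₀, T.output p₀ s₀, fun p => ?_⟩
  obtain ⟨v, s, r, hw⟩ := exists_eq_of_sync_run_bot (hrun (.run p))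
  rw [hw₀] at hw
  simp only [map_some_append_none_cons_inj] at hw
  obtain ⟨-, rfl, houtput, -⟩ := hw
  exact (List.reverse_injective houtput).symm

theorem exists_sync_upstroke_run (p : P) (l s : List S) :
    ∃ p', T.sync.Upstroke (.run p, symStack l) (s.map some)
      (.run p', symStack ((T.out p s).reverse ++ l)) := by
  induction s generalizing p l with
  | nil => exact ⟨p, RunWith.nil _⟩
  | cons x s ih =>
    obtain ⟨p', h⟩ := ih (T.next p x).1 ((T.next p x).2.reverse ++ l)
    obtain ⟨y, υ, hl, hy⟩ := exists_symStack_eq_cons l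
    refine ⟨p', ?_⟩
    rw [hl]
    refine RunWith.cons_of_δ_eq (sync_δ_of_ne_bot hy _ _) (by simp) ?_
    simpa [Upstroke, symStack, out, ← hl] using h

theorem sync_downstroke_run_none (p : P) (l : List S) :
    T.sync.Downstroke (.run p, symStack l) [none] (.check, symStack l) := by
  obtain ⟨y, υ, hl, hy⟩ := exists_symStack_eq_cons l
  rw [hl]
  exact RunWith.cons_of_δ_eq (sync_δ_of_ne_bot hy _ _) (by simp [add_comm]) (.nil _)

theorem sync_downstroke_check (l : List S) :
    T.sync.Downstroke (.check, symStack l) (l.map some ++ [none]) (.done, [.bot]) := by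
  induction l with
  | nil => exact RunWith.cons_of_δ_eq (q' := .done) (γ := []) rfl (by simp) (.nil _)
  | cons x l ih =>
    have hpop : T.sync.δ .check (some x) (.sym x) = (.check, []) := by simp [sync, syncTop]
    exact RunWith.cons_of_δ_eq hpop (by simp) ih

theorem sync_downstroke_bot {q : SyncState P} {a : Option S}
    (h : T.syncBot q a = (.done, [.bot])) (w : List (Option S)) :
    T.sync.Downstroke (q, [.bot]) (a :: w) (.done, [.bot]) := by
  induction w generalizing q a with
  | nil => exact RunWith.cons_of_δ_eq h (by simp) (.nil _)
  | cons b w ih => exact RunWith.cons_of_δ_eq h (by simp) (ih rfl)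

/-- The input on which `sync T` starts all transducers, feeds them with `s`, and compares what they
have printed with `t`. The stack is read off from the top, hence the reversal. -/
def syncWord (s t : List S) : List (Option S) :=
  (none :: s.map some) ++ ([none] ++ (t.reverse.map some ++ [none]))

theorem sync_strokes_syncWord_run (p : P) (s : List S) :
    T.sync.Strokes 2 (.run p, [.bot]) (syncWord s (T.output p s)) (.done, [.bot]) := by
  obtain ⟨p', hrun⟩ := exists_sync_upstroke_run (T := T) (T.start p).1 (T.start p).2.reverse s
  have hup : T.sync.Upstroke (.run p, [.bot]) (none :: s.map some)
      (.run p', symStack (T.output p s).reverse) :=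
    RunWith.cons_of_δ_eq (q' := .run (T.start p).1) (γ := symStack (T.start p).2.reverse) rfl
      (by simp) (by simpa [Upstroke, output] using hrun)
  have hdown := (sync_downstroke_run_none (T := T) p' (T.output p s).reverse).append
    (sync_downstroke_check _)
  exact hup.strokes_append (Downstroke.strokes hdown)

theorem exists_sync_strokes_syncWord {s t : List S} (h : ∀ p, T.output p s = t)
    (q : SyncState P) :
    ∃ k ≤ 2, T.sync.Strokes k (q, [.bot]) (syncWord s t) (.done, [.bot]) := by
  cases q with
  | run p => exact ⟨2, le_rfl, h p ▸ sync_strokes_syncWord_run p s⟩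
  | _ => exact ⟨1, one_le_two, Downstroke.strokes (sync_downstroke_bot rfl _)⟩

theorem exists_isTurnSyncWord_sync_iff {n : ℕ} (hn : 1 ≤ n) (m : StackModel) :
    (∃ w, T.sync.IsTurnSyncWord n m w) ↔ ∃ s t, ∀ p, T.output p s = t := by
  refine ⟨fun ⟨_, h⟩ => exists_forall_output_eq_of_isTurnSyncWord h, fun ⟨s, t, h⟩ =>
    ⟨syncWord s t, isTurnSyncWord_of_strokes_bot (p := .done) fun q => ?_⟩⟩
  obtain ⟨k, hk, hstrokes⟩ := exists_sync_strokes_syncWord h q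
  exact ⟨k, by lia, hstrokes⟩

end Transducer

namespace TuringSimulation

open Turing StateTransition

/-- The queue symbols for the simulation of a Turing machine with tape symbols `Γ`: the cells of
the visited part of the tape, cyclically ordered with `cell none` at the two joined ends, and a
symbol that marks the position of the head while the queue is rotated. -/
inductive QueueSymbol (Γ : Type)
  | cell (x : Option Γ)
  | head
  deriving Fintype

instance {Γ : Type} [Finite Γ] : Finite (QueueSymbol Γ) :=
  let _ := Fintype.ofFinite Γ
  inferInstance

/-- The states for the simulation of a Turing machine with states `Λ`. -/
inductive QueueState (Λ Γ : Type)
  /-- The Turing machine is in state `q` and reads `a`. The queue starts with the cell to the right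
  of the head. -/
  | scan (q : Λ) (a : Γ)
  /-- Rotate the queue until the head is found. The symbol `held` precedes the first symbol of the
  queue. -/
  | seek (q : Λ) (held : Option Γ)
  deriving Fintype

instance {Λ Γ : Type} [Finite Λ] [Finite Γ] : Finite (QueueState Λ Γ) :=
  let _ := Fintype.ofFinite Λ
  let _ := Fintype.ofFinite Γ
  inferInstance

open QueueSymbol QueueState

variable {Γ Λ : Type}

/-- The contents of the queue for a tape with the symbols `L` to the left and `R` to the right of
the head, both listed from the head outwards. -/
def tapeQueue (L R : List Γ) : List (QueueSymbol Γ) :=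
  (R.map some ++ none :: L.reverse.map some).map cell

theorem exists_tapeQueue_eq_cons (L R : List Γ) :
    ∃ y v, tapeQueue L R = cell y :: List.map cell v ∧
      y :: v = R.map some ++ none :: L.reverse.map some := by
  cases R <;> exact ⟨_, _, rfl, rfl⟩

variable [Inhabited Γ]

/-- The transition of the queue automaton that simulates a statement of a Turing machine which reads
`a` and goes to the state `q`, where `y` is the first cell of the queue. -/
def simulateStmt (q : Λ) (a : Γ) : TM0.Stmt Γ → Option Γ → QueueState Λ Γ × List (QueueSymbol Γ)
  | .write b, y => (.seek q y, [.cell (some b), .head])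
  | .move .left, y => (.seek q y, [.head, .cell (some a)])
  | .move .right, some x => (.scan q x, [.cell (some a)])
  | .move .right, none => (.seek q none, [.cell (some a), .cell (some default), .head])

/-- The queue automaton that simulates a Turing machine. If it finds the end of the tape at the new
position of the head, it inserts a blank cell there. -/
def queueAutomaton [Inhabited Λ] (M : TM0.Machine Γ Λ) :
    QueueAutomaton (QueueState Λ Γ) (QueueSymbol Γ) where
  next
    | .scan q a, .cell y => (M q a).map fun d => simulateStmt d.1 a d.2 y
    | .scan _ _, .head => none
    | .seek q y, .cell z => some (.seek q z, [.cell y])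
    | .seek q (some x), .head => some (.scan q x, [])
    | .seek q none, .head => some (.scan q default, [.cell none])

theorem mk₂_headI_tail (L R : List Γ) : Tape.mk₂ L (R.headI :: R.tail) = Tape.mk₂ L R := by
  rw [Tape.mk₂, Tape.mk₂, ← ListBlank.cons_mk, ← ListBlank.tail_mk, ← ListBlank.head_mk,
    ListBlank.cons_head_tail]

theorem write_mk₂ (L R : List Γ) (a b : Γ) :
    (Tape.mk₂ L (a :: R)).write b = Tape.mk₂ L (b :: R) := by
  simp [Tape.mk₂, Tape.write_mk']

theorem move_left_mk₂ (L R : List Γ) :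
    (Tape.mk₂ L R).move .left = Tape.mk₂ L.tail (L.headI :: R) := by
  simp [Tape.mk₂, Tape.move_left_mk']

theorem move_right_mk₂ (L R : List Γ) (a : Γ) :
    (Tape.mk₂ L (a :: R)).move .right = Tape.mk₂ (a :: L) (R.headI :: R.tail) := by
  rw [mk₂_headI_tail]
  simp [Tape.mk₂, Tape.move_right_mk']

variable [Inhabited Λ] {M : TM0.Machine Γ Λ}

theorem reaches_seek (q : Λ) {y z : Option Γ} {v w : List (Option Γ)} (h : y :: v = w ++ [z])
    (t : List (QueueSymbol Γ)) :
    Reaches (queueAutomaton M).step (.seek q y, v.map cell ++ t) (.seek q z, t ++ w.map cell) := by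
  induction v generalizing y w t with
  | nil =>
    obtain ⟨rfl, rfl⟩ : w = [] ∧ z = y := by simpa using List.append_eq_singleton_iff.1 h.symm
    simp [Reaches, Relation.ReflTransGen.refl]
  | cons y' v ih =>
    obtain _ | ⟨x, w⟩ := w
    · simp at h
    rw [List.cons_append, List.cons.injEq] at h
    obtain ⟨rfl, h⟩ := h
    refine .head (b := (.seek q y', v.map cell ++ (t ++ [cell y]))) ?_ ?_
    · simp [QueueAutomaton.step, queueAutomaton]
    · simpa [Reaches] using ih h (t ++ [cell y])

theorem reaches_scan_of_seek_some (q : Λ) {y : Option Γ} {x : Γ} {v w : List (Option Γ)}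
    (h : y :: v = w ++ [some x]) (t : List (QueueSymbol Γ)) :
    Reaches (queueAutomaton M).step (.seek q y, v.map cell ++ head :: t)
      (.scan q x, t ++ w.map cell) := by
  refine (reaches_seek q h _).tail ?_
  simp [QueueAutomaton.step, queueAutomaton]

theorem reaches_scan_of_seek_none (q : Λ) {y : Option Γ} {v w : List (Option Γ)}
    (h : y :: v = w ++ [none]) (t : List (QueueSymbol Γ)) :
    Reaches (queueAutomaton M).step (.seek q y, v.map cell ++ head :: t)
      (.scan q default, t ++ (w ++ [none]).map cell) := by
  refine (reaches_seek q h _).tail ?_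
  simp [QueueAutomaton.step, queueAutomaton]

theorem reaches₁_tapeQueue {q q' : Λ} {a : Γ} {L R : List Γ} {s : TM0.Stmt Γ}
    (h : M q a = some (q', s)) {y : Option Γ} {v : List (Option Γ)}
    (hqueue : tapeQueue L R = cell y :: v.map cell) {d : QueueState Λ Γ × List (QueueSymbol Γ)}
    (hd : Reaches (queueAutomaton M).step ((simulateStmt q' a s y).1,
      v.map cell ++ (simulateStmt q' a s y).2) d) :
    Reaches₁ (queueAutomaton M).step (.scan q a, tapeQueue L R) d := by
  refine .head' ?_ hd
  simp [hqueue, QueueAutomaton.step, queueAutomaton, h]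

theorem reaches₁_write {q q' : Λ} {a b : Γ} (L R : List Γ) (h : M q a = some (q', .write b)) :
    Reaches₁ (queueAutomaton M).step (.scan q a, tapeQueue L R) (.scan q' b, tapeQueue L R) := by
  obtain ⟨y, v, hqueue, hcells⟩ := exists_tapeQueue_eq_cons L R
  refine reaches₁_tapeQueue h hqueue ?_
  have hseek := reaches_scan_of_seek_some (M := M) q' (y := y) (v := v ++ [some b])
    (by rw [← List.cons_append, hcells]) []
  simpa [simulateStmt, tapeQueue] using hseek

theorem reaches₁_move_left {q q' : Λ} {a : Γ} (L R : List Γ)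
    (h : M q a = some (q', .move .left)) :
    Reaches₁ (queueAutomaton M).step (.scan q a, tapeQueue L R)
      (.scan q' L.headI, tapeQueue L.tail (a :: R)) := by
  obtain ⟨y, v, hqueue, hcells⟩ := exists_tapeQueue_eq_cons L R
  refine reaches₁_tapeQueue h hqueue ?_
  cases L with
  | nil =>
    have hseek := reaches_scan_of_seek_none (M := M) q' (w := R.map some) (by simpa using hcells)
      [cell (some a)]
    simpa [simulateStmt, tapeQueue] using hseek
  | cons x L =>
    have hseek := reaches_scan_of_seek_some (M := M) q' (x := x)
      (w := R.map some ++ none :: L.reverse.map some) (by simpa using hcells) [cell (some a)]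
    simpa [simulateStmt, tapeQueue] using hseek

theorem reaches₁_move_right {q q' : Λ} {a : Γ} (L R : List Γ)
    (h : M q a = some (q', .move .right)) :
    Reaches₁ (queueAutomaton M).step (.scan q a, tapeQueue L R)
      (.scan q' R.headI, tapeQueue (a :: L) R.tail) := by
  cases R with
  | nil =>
    refine reaches₁_tapeQueue (y := none) (v := L.reverse.map some) h rfl ?_
    have hseek := reaches_scan_of_seek_some (M := M) q' (x := default) (y := none)
      (v := L.reverse.map some ++ [some a, some default])
      (w := none :: L.reverse.map some ++ [some a]) (by simp) []
    simpa [simulateStmt, tapeQueue] using hseek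
  | cons x R =>
    refine reaches₁_tapeQueue (y := some x) (v := R.map some ++ none :: L.reverse.map some) h rfl ?_
    simp [simulateStmt, tapeQueue, Reaches, Relation.ReflTransGen.refl]

/-- The second configuration, of the queue automaton, represents the first one, of the Turing
machine. -/
inductive Represents : TM0.Cfg Γ Λ → QueueState Λ Γ × List (QueueSymbol Γ) → Prop
  | intro (q : Λ) (a : Γ) (L R : List Γ) :
      Represents ⟨q, Tape.mk₂ L (a :: R)⟩ (.scan q a, tapeQueue L R)

theorem respects_represents :
    Respects (TM0.step M) (queueAutomaton M).step Represents := by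
  rintro _ _ ⟨q, a, L, R⟩
  have hhead : (Tape.mk₂ L (a :: R)).head = a := by simp [Tape.mk₂]
  cases h : M q a with
  | none =>
    obtain ⟨y, v, hqueue, -⟩ := exists_tapeQueue_eq_cons L R
    simp [TM0.step, hhead, h, hqueue, QueueAutomaton.step, queueAutomaton]
  | some d =>
    simp only [TM0.step, hhead, h, Option.map_some]
    obtain ⟨q', (_ | _) | b⟩ := d
    · exact ⟨_, by simpa only [move_left_mk₂] using .intro .., reaches₁_move_left L R h⟩
    · exact ⟨_, by simpa only [move_right_mk₂] using .intro .., reaches₁_move_right L R h⟩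
    · exact ⟨_, by simpa only [write_mk₂] using .intro .., reaches₁_write L R h⟩

/-- The contents of the queue from which the search for the head builds up the contents for a tape
with the symbols `l` from the head on to the right, and blanks elsewhere. -/
def startQueue (l : List Γ) : List (QueueSymbol Γ) :=
  cell (some l.headI) :: head :: l.tail.map fun a => cell (some a)

theorem eval_queueAutomaton_dom_iff (M : TM0.Machine Γ Λ) (l : List Γ) :
    (eval (queueAutomaton M).step (.seek default none, startQueue l)).Dom ↔
      (TM0.eval M l).Dom := by
  have hseek : Reaches (queueAutomaton M).step (.seek default none, startQueue l)
      (.scan default l.headI, tapeQueue [] l.tail) := by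
    simpa [startQueue, tapeQueue, Function.comp_def] using
      reaches_scan_of_seek_some (M := M) default (w := [none]) rfl
        (l.tail.map fun a => cell (some a))
  have hinit : TM0.init l = ⟨(default : Λ), Tape.mk₂ [] (l.headI :: l.tail)⟩ := by
    rw [mk₂_headI_tail]
    rfl
  rw [reaches_eval hseek]
  exact tr_eval_dom respects_represents (a₁ := TM0.init l) (hinit ▸ .intro ..)

theorem primrec_startQueue [Finite Γ] [Primcodable Γ] [Primcodable (QueueSymbol Γ)] :
    Primrec (startQueue (Γ := Γ)) :=
  Primrec.list_cons.comp
    ((Primrec.dom_finite fun a => cell (some a)).comp Primrec.list_headI)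
    (Primrec.list_cons.comp (.const _)
      (.list_map .list_tail ((Primrec.dom_finite fun a => cell (some a)).comp Primrec.snd).to₂))

end TuringSimulation

namespace DPDA

variable {Q A Γ Q' A' Γ' : Type}

/-- Renaming of the states, input letters and stack symbols of an automaton. -/
def mapEquiv (M : DPDA Q A Γ) (f : Q ≃ Q') (g : A ≃ A') (h : Γ ≃ Γ') : DPDA Q' A' Γ' where
  bot := h M.bot
  δ q a x := (f (M.δ (f.symm q) (g.symm a) (h.symm x)).1,
    (M.δ (f.symm q) (g.symm a) (h.symm x)).2.map h)
  bot_lowest q a x hx := by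
    have := M.bot_lowest (f.symm q) (g.symm a) (h.symm x) (by simpa using hx)
    refine ⟨by rw [← this.1]; simp, ?_⟩
    rw [← List.map_dropLast, List.mem_map_of_injective h.injective]
    exact this.2

variable {M : DPDA Q A Γ} (f : Q ≃ Q') (g : A ≃ A') (h : Γ ≃ Γ')

theorem mapEquiv_symm :
    (M.mapEquiv f g h).mapEquiv f.symm g.symm h.symm = M := by
  rcases M with ⟨b, δ, hb⟩
  simp [mapEquiv]

theorem RunWith.mapEquiv {R : ℕ → ℕ → Prop} {c d : Q × List Γ} {w : List A}
    (hw : M.RunWith R c w d) :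
    (M.mapEquiv f g h).RunWith R (c.map f (List.map h)) (w.map g) (d.map f (List.map h)) := by
  induction hw with
  | nil => exact .nil _
  | @cons c d e a w hs hR _ ih =>
    refine .cons ?_ (by simpa using hR) ih
    obtain ⟨q, _ | ⟨x, υ⟩⟩ := c
    · exact hs.elim
    · cases hs
      simp [Step, DPDA.mapEquiv]

theorem Strokes.mapEquiv {k : ℕ} {c d : Q × List Γ} {w : List A} (hw : M.Strokes k c w d) :
    (M.mapEquiv f g h).Strokes k (c.map f (List.map h)) (w.map g) (d.map f (List.map h)) := by
  induction hw with
  | zero => exact .zero _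
  | succ hs _ ih =>
    rw [List.map_append]
    exact .succ (hs.imp (RunWith.mapEquiv f g h) (RunWith.mapEquiv f g h)) ih

theorem IsTurnSyncWord.mapEquiv {n : ℕ} {m : StackModel} {w : List A}
    (hw : M.IsTurnSyncWord n m w) : (M.mapEquiv f g h).IsTurnSyncWord n m (w.map g) := by
  obtain ⟨p, υ, hr, hm, hs⟩ := hw
  refine ⟨f p, fun q => (υ (f.symm q)).map h, fun q => ?_, ?_, fun q => ?_⟩
  · have := RunWith.mapEquiv f g h (hr (f.symm q))
    rwa [Prod.map_apply, f.apply_symm_apply] at this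
  · cases m
    · exact fun q => congrArg (List.map h) (hm (f.symm q))
    · exact fun q q' => congrArg (List.map h) (hm (f.symm q) (f.symm q'))
    · trivial
  · obtain ⟨k, hk, hs⟩ := hs (f.symm q)
    have := hs.mapEquiv f g h
    rw [Prod.map_apply, f.apply_symm_apply] at this
    exact ⟨k, hk, this⟩

theorem exists_isTurnSyncWord_mapEquiv_iff {n : ℕ} {m : StackModel} :
    (∃ w, (M.mapEquiv f g h).IsTurnSyncWord n m w) ↔ ∃ w, M.IsTurnSyncWord n m w := by
  constructor
  · rintro ⟨w, hw⟩
    have := hw.mapEquiv f.symm g.symm h.symm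
    rw [mapEquiv_symm] at this
    exact ⟨_, this⟩
  · rintro ⟨w, hw⟩
    exact ⟨_, hw.mapEquiv f g h⟩

end DPDA

theorem nonempty_primcodable (α : Type) [Finite α] : Nonempty (Primcodable α) := by
  obtain ⟨n, ⟨e⟩⟩ := Finite.exists_equiv_fin α
  exact ⟨.ofEquiv (Fin n) e⟩

namespace FinDPDA

variable {Q A Γ : Type} [Finite Q] [Finite A] [Finite Γ] [Nonempty Q]

/-- An automaton with finitely many states, letters and stack symbols, with these numbered. -/
noncomputable def ofDPDA (M : DPDA Q A Γ) : FinDPDA where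
  numStates := Nat.card Q
  numLetters := Nat.card A
  numStack := Nat.card Γ
  numStates_pos := Nat.card_pos
  toDPDA := M.mapEquiv (Finite.equivFin Q) (Finite.equivFin A) (Finite.equivFin Γ)

theorem turnSync_ofDPDA_iff (M : DPDA Q A Γ) (n : ℕ) (m : DPDA.StackModel) :
    TurnSync n m (ofDPDA M) ↔ ∃ w, M.IsTurnSyncWord n m w :=
  DPDA.exists_isTurnSyncWord_mapEquiv_iff _ _ _

theorem primrec_code_ofDPDA {α : Type} [Primcodable α] [Primcodable Q] [Primcodable Γ]
    {M : α → DPDA Q A Γ} (hbot : Primrec fun i => (M i).bot)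
    (hδ : ∀ q a x, Primrec fun i => (M i).δ q a x) : Primrec fun i => (ofDPDA (M i)).code := by
  let number {X : Type} [Finite X] (x : X) : ℕ := Finite.equivFin X x
  have entry (q a x) : Primrec fun i =>
      (number ((M i).δ q a x).1, ((M i).δ q a x).2.map number) :=
    .pair ((Primrec.dom_finite number).comp (Primrec.fst.comp (hδ q a x)))
      (.list_map (Primrec.snd.comp (hδ q a x)) ((Primrec.dom_finite number).comp Primrec.snd).to₂)
  have table := Primrec.list_ofFn fun q => Primrec.list_ofFn fun a => Primrec.list_ofFn fun x =>
    entry ((Finite.equivFin Q).symm q) ((Finite.equivFin A).symm a) ((Finite.equivFin Γ).symm x)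
  refine ((Primrec.const (Nat.card Q)).pair ((Primrec.const (Nat.card A)).pair
    ((Primrec.const (Nat.card Γ)).pair
      (((Primrec.dom_finite number).comp hbot).pair table)))).of_eq fun i => ?_
  simp [code, ofDPDA, DPDA.mapEquiv, number, Function.comp_def]

end FinDPDA

namespace Transducer

variable {α P S : Type} [Primcodable α] [Primcodable P] [Primcodable S] [Finite P] [Finite S]
  [DecidableEq S] [Primcodable (SyncState P)] [Primcodable (SyncStack S)]

theorem primrec_sync_δ {T : α → Transducer P S} (hstart : ∀ p, Primrec fun i => (T i).start p)
    (hnext : ∀ p x, Primrec fun i => (T i).next p x) (q : SyncState P) (a : Option S)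
    (y : SyncStack S) : Primrec fun i => (T i).sync.δ q a y := by
  have toRun {f : α → P × List S} (hf : Primrec f) (υ : List (SyncStack S)) :
      Primrec fun i => (SyncState.run (f i).1, (f i).2.reverse.map .sym ++ υ) :=
    .pair ((Primrec.dom_finite _).comp (Primrec.fst.comp hf)) (Primrec.list_append.comp
      (.list_map (Primrec.list_reverse.comp (Primrec.snd.comp hf))
        ((Primrec.dom_finite _).comp Primrec.snd).to₂) (.const υ))
  cases q with
  | run p =>
    cases y with
    | bot => cases a with
      | none => exact toRun (hstart p) _
      | some x => exact .const _
    | _ => cases a with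
      | none => exact .const _
      | some x => exact toRun (hnext p x) _
  | _ => cases y <;> cases a <;> exact .const _

end Transducer

section TuringMachines

open Turing StateTransition PartrecToTM2

/-- Adding one to a number in binary, as a list of digits with the lowest digit first. -/
def binarySucc : List Γ' → List Γ'
  | .bit0 :: l => .bit1 :: l
  | .bit1 :: l => .bit0 :: binarySucc l
  | _ => [.bit1]

theorem trNat_succ (n : ℕ) : trNat (n + 1) = binarySucc (trNat n) := by
  have trPosNum_succ (p : PosNum) : trPosNum p.succ = binarySucc (trPosNum p) := by
    induction p with
    | one => rfl
    | bit0 p _ => rfl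
    | bit1 p ih => exact congrArg (Γ'.bit0 :: ·) ih
  rw [trNat, trNat, Nat.cast_succ, Num.add_one]
  cases (n : Num) with
  | zero => rfl
  | pos p => exact trPosNum_succ p

theorem primrec_binarySucc [Primcodable Γ'] : Primrec binarySucc := by
  have := Primrec.list_rec (α := List Γ') .id (.const [Γ'.bit1])
    (h := fun _ p => if p.1 = .bit0 then .bit1 :: p.2.1
      else if p.1 = .bit1 then .bit0 :: p.2.2 else [.bit1])
    (by
      have digit : Primrec fun x : List Γ' × Γ' × List Γ' × List Γ' => x.2.1 :=
        .comp .fst .snd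
      have tail := Primrec.snd.comp (Primrec.snd (α := List Γ') (β := Γ' × List Γ' × List Γ'))
      exact .ite (Primrec.eq.comp digit (.const _))
        (Primrec.list_cons.comp (.const _) (Primrec.fst.comp tail))
        (.ite (Primrec.eq.comp digit (.const _))
          (Primrec.list_cons.comp (.const _) (Primrec.snd.comp tail)) (.const _)))
  refine this.of_eq fun l => ?_
  induction l with
  | nil => rfl
  | cons d l ih => cases d <;> simp_all [binarySucc]

theorem primrec_trNat [Primcodable Γ'] : Primrec trNat := by
  refine (Primrec.nat_rec₁ [] (primrec_binarySucc.comp Primrec.snd).to₂).of_eq fun n => ?_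
  induction n with
  | zero => exact trNat_zero.symm
  | succ n ih => rw [trNat_succ, ← ih]

theorem exists_toPartrec_code_not_computablePred_dom :
    ∃ c : ToPartrec.Code, ¬ ComputablePred fun n : ℕ => (c.eval [n]).Dom := by
  have universal : Partrec fun n : ℕ => (Denumerable.ofNat Nat.Partrec.Code n).eval 0 :=
    Nat.Partrec.Code.eval_part.comp (.ofNat _) (.const 0)
  obtain ⟨c, hc⟩ := ToPartrec.Code.exists_code (Nat.Partrec'.part_iff₁.2 universal)
  refine ⟨c, fun h => ComputablePred.halting_problem 0
    (ComputablePred.computable_of_manyOneReducible ⟨_, Computable.encode, fun k => ?_⟩ h)⟩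
  have eval_singleton : c.eval [Encodable.encode k] = pure <$> k.eval 0 := by
    have := hc ⟨[Encodable.encode k], rfl⟩
    rwa [List.Vector.head, Denumerable.ofNat_encode] at this
  simp [eval_singleton]

theorem exists_finite_tm0_eval_dom_iff {Γ Λ : Type} [Inhabited Γ] [Inhabited Λ]
    (M : TM0.Machine Γ Λ) {S : Set Λ} (hfin : S.Finite) (hS : TM0.Supports M S) :
    ∃ (Λ' : Type) (_ : Inhabited Λ') (_ : Finite Λ') (M' : TM0.Machine Γ Λ'),
      ∀ l, (TM0.eval M' l).Dom ↔ (TM0.eval M l).Dom := by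
  classical
  have := hfin.to_subtype
  let _ : Inhabited S := ⟨⟨default, hS.1⟩⟩
  let restrict : PointedMap Λ S := ⟨fun q => if h : q ∈ S then ⟨q, h⟩ else default, dif_pos hS.1⟩
  let f : PointedMap Γ Γ := ⟨id, rfl⟩
  have hrespects := TM0.Machine.map_respects M f f restrict Subtype.val hS (fun _ => rfl)
    fun q hq => congrArg Subtype.val (dif_pos hq)
  refine ⟨S, inferInstance, inferInstance, M.map f f restrict Subtype.val, fun l =>
    tr_eval_dom hrespects ⟨hS.1, ?_⟩⟩
  rw [TM0.map_init f restrict l]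
  exact congrArg _ (List.map_id l)

instance : Fintype K' := ⟨{.main, .rev, .aux, .stack}, by rintro (_ | _) <;> decide⟩

theorem tm2_eval_tr_dom (c : ToPartrec.Code) (v : List ℕ) :
    letI : Inhabited Λ' := ⟨trNormal c .halt⟩
    (TM2.eval tr K'.main (trList v)).Dom ↔ (c.eval v).Dom := by
  let _ : Inhabited Λ' := ⟨trNormal c .halt⟩
  have init_eq : TM2.init K'.main (trList v) = init c v := by
    simp only [TM2.init, init]
    congr 1
    funext k
    cases k <;> rfl
  change (StateTransition.eval (TM2.step tr) (TM2.init K'.main (trList v))).Dom ↔ _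
  simp [init_eq, PartrecToTM2.tr_eval]

theorem exists_finite_tm0_eval_trInit_dom_iff (c : ToPartrec.Code) :
    ∃ (Λ : Type) (_ : Inhabited Λ) (_ : Finite Λ)
      (M : TM0.Machine (TM2to1.Γ' K' fun _ => Γ') Λ),
      ∀ v, (TM0.eval M (TM2to1.trInit K'.main (trList v))).Dom ↔ (c.eval v).Dom := by
  let _ : Inhabited Λ' := ⟨trNormal c .halt⟩
  have hS := TM1to0.tr_supports (TM2to1.tr tr) (TM2to1.tr_supports tr (tr_supports c .halt))
  obtain ⟨Λ, _, _, M, hM⟩ := exists_finite_tm0_eval_dom_iff _ (Finset.finite_toSet _) hS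
  refine ⟨Λ, _, ‹_›, M, fun v => ?_⟩
  rw [hM, TM1to0.tr_eval]
  exact (TM2to1.tr_eval_dom tr _ _).trans (tm2_eval_tr_dom c v)

theorem primrec_trInit {K : Type} [DecidableEq K] {Γ : K → Type} [Finite (TM2to1.Γ' K Γ)]
    (k : K) [Primcodable (Γ k)] [Finite (Γ k)] [Primcodable (TM2to1.Γ' K Γ)] :
    Primrec (TM2to1.trInit (Γ := Γ) k) := by
  let cell (a : Γ k) : TM2to1.Γ' K Γ := (false, Function.update (fun _ => none) k (some a))
  let markBottom (a : TM2to1.Γ' K Γ) : TM2to1.Γ' K Γ := (true, a.2)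
  have cells : Primrec fun l : List (Γ k) => l.reverse.map cell :=
    Primrec.list_map .list_reverse ((Primrec.dom_finite cell).comp Primrec.snd).to₂
  exact Primrec.list_cons.comp ((Primrec.dom_finite markBottom).comp
    (Primrec.list_headI.comp cells)) (Primrec.list_tail.comp cells)

open TuringSimulation in
theorem exists_finite_queueAutomaton_not_computablePred_eval_dom :
    ∃ (P S : Type) (_ : Finite P) (_ : Finite S) (_ : Primcodable S) (A : QueueAutomaton P S)
      (p : P) (u : ℕ → List S),
      Primrec u ∧ ¬ ComputablePred fun i => (eval A.step (p, u i)).Dom := by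
  obtain ⟨c, hc⟩ := exists_toPartrec_code_not_computablePred_dom
  obtain ⟨Λ, _, _, M, hM⟩ := exists_finite_tm0_eval_trInit_dom_iff c
  obtain ⟨_⟩ := nonempty_primcodable Γ'
  obtain ⟨_⟩ := nonempty_primcodable (TM2to1.Γ' K' fun _ => Γ')
  obtain ⟨_⟩ := nonempty_primcodable (QueueSymbol (TM2to1.Γ' K' fun _ => Γ'))
  refine ⟨_, _, inferInstance, inferInstance, inferInstance, queueAutomaton M, .seek default none,
    fun n => startQueue (TM2to1.trInit K'.main (trList [n])), ?_, ?_⟩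
  · have primrec_trList : Primrec fun n => trList [n] :=
      Primrec.list_append.comp primrec_trNat (.const [Γ'.cons])
    exact primrec_startQueue.comp ((primrec_trInit K'.main).comp primrec_trList)
  · simpa only [eval_queueAutomaton_dom_iff, hM] using hc

end TuringMachines

section Reduction

variable {P S α : Type} [Primcodable α] [Primcodable S] {A : QueueAutomaton P S} {p₀ : P}
  {u : α → List S}

theorem QueueAutomaton.primrec_transducer_start [Primcodable (TransducerState P)]
    (hu : Primrec u) (q : TransducerState P) :
    Primrec fun i => (A.transducer p₀ (u i)).start q := by
  cases q with
  | copy => exact .const _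
  | _ => exact .pair (.const _) hu

open Transducer QueueAutomaton in
theorem primrec_code_sync_transducer [Finite P] [Finite S] [DecidableEq S] (hu : Primrec u) :
    Primrec fun i => (FinDPDA.ofDPDA (A.transducer p₀ (u i)).sync).code := by
  obtain ⟨_⟩ := nonempty_primcodable (TransducerState P)
  obtain ⟨_⟩ := nonempty_primcodable (SyncState (TransducerState P))
  obtain ⟨_⟩ := nonempty_primcodable (SyncStack S)
  exact FinDPDA.primrec_code_ofDPDA (.const (SyncStack.bot : SyncStack S)) fun q a y =>
    primrec_sync_δ (primrec_transducer_start hu)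
      (fun p x => by cases p <;> exact .const _) q a y

end Reduction

open FinDPDA in
theorem mainTheorem3_general {n : ℕ} (hn : 1 ≤ n) (m : DPDA.StackModel) :
    ¬ IsDecidable (TurnSync n m) := by
  classical
  rintro ⟨D, hD, hD_iff⟩
  obtain ⟨P, S, _, _, _, A, p₀, u, hu, hhalt⟩ :=
    exists_finite_queueAutomaton_not_computablePred_eval_dom
  refine hhalt (ComputablePred.computable_of_manyOneReducible
    ⟨_, (primrec_code_sync_transducer (A := A) (p₀ := p₀) hu).to_comp, fun i => ?_⟩ hD)
  rw [hD_iff, turnSync_ofDPDA_iff, Transducer.exists_isTurnSyncWord_sync_iff hn,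
    QueueAutomaton.exists_forall_output_eq_iff]

theorem mainTheorem3 :
    ¬ FinDPDA.IsDecidable (FinDPDA.TurnSync 1 DPDA.StackModel.empty) ∧
    ¬ FinDPDA.IsDecidable (FinDPDA.TurnSync 1 DPDA.StackModel.same) ∧
    ¬ FinDPDA.IsDecidable (FinDPDA.TurnSync 1 DPDA.StackModel.arbitrary) :=
  ⟨mainTheorem3_general le_rfl _, mainTheorem3_general le_rfl _, mainTheorem3_general le_rfl _⟩
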